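/- Let $\kappa$ be a regular (infinite) cardinal. For sets of ordinals $A,B$ write $A<B$ if $\alpha<\beta$ for all $\alpha\in A$, $\beta\in B$. For $\mu\subseteq\{X\subseteq\kappa^+ : |X|<\kappa\}$ and $X\subseteq\kappa^+$ put $\mu|X=\{Y\in\mu : Y\subsetneq X\}$, and call a family $\nu$ of sets directed if for all $X,Y\in\nu$ there is $Z\in\nu$ with $X\cup Y\subseteq Z$ (so the empty family is directed). Write $X=X_1*X_2$ if $X=X_1\cup X_2$, the sets $X_1,X_2$ have the same order type, and $X_1\cap X_2<X_1\setminus X_2<X_2\setminus X_1$. A $(\kappa,\kappa^+)$-cardinal is a family $\mu\subseteq\{X\subseteq\kappa^+ : |X|<\kappa\}$ such that 1. $\mu$ is well-founded with respect to inclusion; $\operatorname{rank}(X)$ denotes the rank of $X\in\mu$ in $(\mu,\subsetneq)$; 2. $|\mu|X|<\kappa$ for all $X\in\mu$ (that is, the family $\mu|X$ has fewer than $\kappa$ members); 3. if $X,Y\in\mu$ and $\operatorname{rank}(X)=\operatorname{rank}(Y)$, then $X$ and $Y$ have the same order type and $\mu|Y=\{f_{YX}[Z] : Z\in\mu|X\}$,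 where $f_{YX}:X\to Y$ is the unique order-preserving bijection; 4. $\mu$ is directed; 5. for every $X\in\mu$, either $\mu|X$ is directed, or there are $X_1,X_2\in\mu$ of the same rank with $X=X_1*X_2$ and $\mu|X=(\mu|X_1)\cup(\mu|X_2)\cup\{X_1,X_2\}$; 6. $\bigcup\mu=\kappa^+$; 7. $X=\bigcup(\mu|X)$ for every $X\in\mu$ of nonzero rank. The $\mu$-coloring $m:[\kappa^+]^2\to\kappa$ is defined by $m(\alpha,\beta)=m(\{\alpha,\beta\})=\min\{\operatorname{rank}(X) : \alpha,\beta\in X\in\mu\}$. **Proposition.** Let $\lambda$ be an infinite regular cardinal with $\lambda^{<\lambda}=\lambda$, let $\kappa=\lambda^+$, let $\mu$ be a $(\kappa,\kappa^+)$-cardinal, and let $m$ be the $\mu$-coloring. Let $(a_\xi)_{\xi<\kappa}$ be a family of subsets of $\kappa^+$, each of cardinality smaller than $\lambda$. Then there is $A\subseteq\kappa$ of cardinality $\kappa$ such that for all $\xi,\eta\in A$, all $\tau\in a_\xi\cap a_\eta$, all $\alpha\in a_\xi\setminus a_\eta$ and all $\beta\in a_\eta\setminus a_\xi$: 1. if $\beta>\tau$,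 then $m(\alpha,\tau)\le m(\alpha,\beta)$; 2. if $\alpha>\tau$, then $m(\beta,\tau)\le m(\alpha,\beta)$. -/

import Mathlib

open Cardinal Ordinal

universe u

/-- The set `κ⁺` of all ordinals below the successor cardinal of `κ`, as a well-ordered type. -/
abbrev SuccCard (κ : Cardinal.{u}) : Type u := (Order.succ κ).ord.ToType

/-- `μ | X`, the family of those members of `μ` that are proper subsets of `X`. -/
def familyBelow {α : Type u} (μ : Set (Set α)) (X : Set α) : Set (Set α) :=
  {Y | Y ∈ μ ∧ Y ⊂ X}

/-- The family `μ` is well-founded with respect to (strict) inclusion. -/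
def FamilyWF {α : Type u} (μ : Set (Set α)) : Prop :=
  WellFounded (fun X Y : μ => (X : Set α) ⊂ (Y : Set α))

/-- The rank of a member `X` of a well-founded family `μ`, i.e. the least ordinal that is greater
than the ranks of all members of `μ` strictly included in `X`. -/
noncomputable def FamilyWF.rank {α : Type u} {μ : Set (Set α)} (hμ : FamilyWF μ) (X : μ) :
    Ordinal.{u} :=
  (hμ.apply X).rank

/-- The family `μ` is directed: any two members are included in a third one. -/
def FamilyDirected {α : Type u} (μ : Set (Set α)) : Prop :=
  ∀ X ∈ μ, ∀ Y ∈ μ, ∃ Z ∈ μ, X ⊆ Z ∧ Y ⊆ Z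

/-- The image `f[Z]` of a subset `Z` of `X` under an order isomorphism `f` from `X` onto `Y`. -/
def isoImage {α : Type u} [LinearOrder α] {X Y : Set α} (f : X ≃o Y) (Z : Set α) : Set α :=
  {y | ∃ x : X, (x : α) ∈ Z ∧ (f x : α) = y}

/-- `X = X₁ * X₂`: the sets `X₁` and `X₂` have the same order type,
`X₁ ∩ X₂ < X₁ \ X₂ < X₂ \ X₁`, and `X = X₁ ∪ X₂`. -/
def IsStar {α : Type u} [LinearOrder α] (X X₁ X₂ : Set α) : Prop :=
  Nonempty (X₁ ≃o X₂) ∧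
  (∀ x ∈ X₁ ∩ X₂, ∀ y ∈ X₁ \ X₂, x < y) ∧
  (∀ y ∈ X₁ \ X₂, ∀ z ∈ X₂ \ X₁, y < z) ∧
  X = X₁ ∪ X₂

/-- `μ` is a `(κ, κ⁺)`-cardinal (a neat simplified `(κ, 1)`-morass, as a family of sets). In
`homogeneous`, the isomorphism `f` is unique, because `X` and `Y` are well-ordered. -/
structure IsTwoCardinal (κ : Cardinal.{u}) (μ : Set (Set (SuccCard κ))) : Prop where
  regular : κ.IsRegular
  card_lt : ∀ X ∈ μ, #X < κ
  wf : FamilyWF μ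
  locallySmall : ∀ X ∈ μ, #(familyBelow μ X) < κ
  homogeneous : ∀ X Y : μ, wf.rank X = wf.rank Y →
    ∃ f : (X : Set (SuccCard κ)) ≃o (Y : Set (SuccCard κ)),
      familyBelow μ Y = {W | ∃ Z ∈ familyBelow μ X, W = isoImage f Z}
  directed : FamilyDirected μ
  locallyAlmostDirected : ∀ X : μ, FamilyDirected (familyBelow μ X) ∨
    ∃ X₁ X₂ : μ, wf.rank X₁ = wf.rank X₂ ∧
      IsStar (X : Set (SuccCard κ)) X₁ X₂ ∧
      familyBelow μ X = familyBelow μ X₁ ∪ familyBelow μ X₂ ∪ {X₁.1, X₂.1}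
  covers : ⋃₀ μ = Set.univ
  neat : ∀ X : μ, wf.rank X ≠ 0 → (X : Set (SuccCard κ)) = ⋃₀ familyBelow μ X

/-- The `μ`-coloring `m(α, β) = min {rank X : α, β ∈ X ∈ μ}` of the pairs from `κ⁺`. -/
noncomputable def IsTwoCardinal.coloring {κ : Cardinal.{u}} {μ : Set (Set (SuccCard κ))}
    (hμ : IsTwoCardinal κ μ) (α β : SuccCard κ) : Ordinal.{u} :=
  sInf {r | ∃ X : μ, α ∈ (X : Set (SuccCard κ)) ∧ β ∈ (X : Set (SuccCard κ)) ∧ hμ.wf.rank X = r}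

/-- The minimum defining the `μ`-coloring is attained. -/
theorem IsTwoCardinal.exists_coloring {κ : Cardinal.{u}} {μ : Set (Set (SuccCard κ))}
    (hμ : IsTwoCardinal κ μ) (α β : SuccCard κ) :
    ∃ X : μ, α ∈ (X : Set (SuccCard κ)) ∧ β ∈ (X : Set (SuccCard κ)) ∧
      hμ.wf.rank X = hμ.coloring α β := by
  have hα : α ∈ ⋃₀ μ := hμ.covers ▸ Set.mem_univ α
  have hβ : β ∈ ⋃₀ μ := hμ.covers ▸ Set.mem_univ β
  obtain ⟨X, hX, hαX⟩ := hα
  obtain ⟨Y, hY, hβY⟩ := hβ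
  obtain ⟨Z, hZ, hXZ, hYZ⟩ := hμ.directed X hX Y hY
  exact csInf_mem (s := {r | ∃ X : μ, α ∈ (X : Set (SuccCard κ)) ∧
    β ∈ (X : Set (SuccCard κ)) ∧ hμ.wf.rank X = r}) ⟨_, ⟨Z, hZ⟩, hXZ hαX, hYZ hβY, rfl⟩

/-- Ranks in a `(κ, κ⁺)`-cardinal are ordinals below `κ`. -/
theorem IsTwoCardinal.rank_lt {κ : Cardinal.{u}} {μ : Set (Set (SuccCard κ))}
    (hμ : IsTwoCardinal κ μ) (X : μ) : hμ.wf.rank X < κ.ord := by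
  induction X using hμ.wf.induction with
  | _ X ih =>
    rw [FamilyWF.rank, Acc.rank_eq]
    refine Ordinal.iSup_lt_of_lt_cof ?_ ?_
    · rw [hμ.regular.cof_ord]
      refine lt_of_le_of_lt ?_ (hμ.locallySmall X X.2)
      exact Cardinal.mk_le_of_injective
        (f := fun b : {b : μ // (b : Set (SuccCard κ)) ⊂ X} =>
          (⟨b.1.1, b.1.2, b.2⟩ : familyBelow μ X))
        (fun b c h => by
          have h2 : (b.1.1 : Set (SuccCard κ)) = c.1.1 := congrArg (fun y => y.1) h
          exact Subtype.ext (Subtype.ext h2))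
    · intro b
      exact (Cardinal.isSuccLimit_ord hμ.regular.aleph0_le).succ_lt (ih b.1 b.2)

/-- The values of the `μ`-coloring are ordinals below `κ`. -/
theorem IsTwoCardinal.coloring_lt {κ : Cardinal.{u}} {μ : Set (Set (SuccCard κ))}
    (hμ : IsTwoCardinal κ μ) (α β : SuccCard κ) : hμ.coloring α β < κ.ord := by
  obtain ⟨X, -, -, h⟩ := hμ.exists_coloring α β
  exact h ▸ hμ.rank_lt X

/-! Members of `μ` of equal rank agree below any common point (`mem_of_le`). Hence `m` satisfies two
ultrametric inequalities (`coloring_le_max_of_le_of_le`, `coloring_le_max_of_le`), and below a fixed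
point the elements of color at most `δ` are told apart by their positions, which are ordinals
bounded below `κ`.

Number the union of the family by ordinals below `κ`. Consider points `η` closed under the relevant
operations, below which sets of size less than `λ` are bounded, and give each `η` a code: the
numbers of `a η` and the positions arising from it that lie below `η`. The core is
`exists_bound_of_isBadFor`: for fixed `τ`, `β`, the closed `ξ < η` with the code of `η` at which the
conclusion fails are bounded below `η`. Such a failure has `α < β`. If `τ < α`, then `m τ α = m β
τ`, and once `ξ` exceeds this color, a position in the code of `η` determines `α` and so `ξ`; there
are fewer than `λ` of these. If `α < τ`, reflection replaces `β` by some `γ` with `m τ γ < η`, and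
`ξ ≤ m τ γ`.

Thus all failures at `η` lie below some `g η < η`. Pressing down bounds `g` by a fixed `γ` on an
unbounded set; as `λ^{<λ} = λ`, few codes occur there, and `κ` many points above `γ` share one. No
two of them fail. -/

/-! ### Order isomorphisms and stars -/

section IsoImage

variable {α : Type u} [LinearOrder α] {X Y : Set α}

theorem apply_mem_isoImage (f : X ≃o Y) {Z : Set α} (x : X) :
    (f x : α) ∈ isoImage f Z ↔ (x : α) ∈ Z := by
  constructor
  · rintro ⟨y, hy, h⟩
    rwa [← f.injective (Subtype.ext h)]
  · exact fun h => ⟨x, h, rfl⟩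

theorem isoImage_subset_isoImage (f : X ≃o Y) {Z W : Set α} (hZ : Z ⊆ X) :
    isoImage f Z ⊆ isoImage f W ↔ Z ⊆ W := by
  constructor
  · intro h z hz
    exact (apply_mem_isoImage f ⟨z, hZ hz⟩).1 (h ((apply_mem_isoImage f ⟨z, hZ hz⟩).2 hz))
  · rintro h _ ⟨x, hx, rfl⟩
    exact ⟨x, h hx, rfl⟩

theorem isoImage_ssubset_isoImage (f : X ≃o Y) {Z W : Set α} (hZ : Z ⊆ X) (hW : W ⊆ X) :
    isoImage f Z ⊂ isoImage f W ↔ Z ⊂ W := by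
  simp only [Set.ssubset_def, isoImage_subset_isoImage f hZ, isoImage_subset_isoImage f hW]

/-- An isomorphism between two sets of ordinals fixes every point of a common initial segment. -/
theorem orderIso_apply_eq_self [WellFoundedLT α] (f : X ≃o Y) {a : α}
    (h : ∀ b ≤ a, b ∈ X ↔ b ∈ Y) : ∀ b (hb : b ∈ X), b ≤ a → (f ⟨b, hb⟩ : α) = b := by
  intro b
  induction b using WellFoundedLT.induction with
  | _ b ih =>
    intro hb hba
    rcases lt_trichotomy (f ⟨b, hb⟩ : α) b with hlt | heq | hgt
    · have hX : (f ⟨b, hb⟩ : α) ∈ X := (h _ (hlt.le.trans hba)).2 (f ⟨b, hb⟩).2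
      have h1 := ih _ hlt hX (hlt.le.trans hba)
      have h2 := f.injective (Subtype.ext h1)
      exact absurd (congrArg Subtype.val h2) hlt.ne
    · exact heq
    · obtain ⟨c, hc⟩ := f.surjective ⟨b, (h b hba).1 hb⟩
      have hcb : c < ⟨b, hb⟩ := by
        rw [← f.lt_iff_lt, hc]
        exact hgt
      have h1 := ih c hcb c.2 ((show (c : α) < b from hcb).le.trans hba)
      rw [hc] at h1
      exact absurd h1.symm (show (c : α) < b from hcb).ne

/-- A common point lies below `X₁ \ X₂`, and through a point of that set also below `X₂ \ X₁`; this
is why it must be nonempty. -/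
theorem IsStar.mem_iff {X₁ X₂ : Set α} (h : IsStar X X₁ X₂) (hne : (X₁ \ X₂).Nonempty) {a : α}
    (ha₁ : a ∈ X₁) (ha₂ : a ∈ X₂) : ∀ b ≤ a, b ∈ X₁ ↔ b ∈ X₂ := by
  obtain ⟨-, h1, h2, -⟩ := h
  obtain ⟨c, hc⟩ := hne
  intro b hb
  constructor
  · intro hb₁
    by_contra hb₂
    exact absurd (h1 a ⟨ha₁, ha₂⟩ b ⟨hb₁, hb₂⟩) hb.not_gt
  · intro hb₂
    by_contra hb₁
    exact absurd ((h1 a ⟨ha₁, ha₂⟩ c hc).trans (h2 c hc b ⟨hb₂, hb₁⟩)) hb.not_gt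

end IsoImage

/-! ### Ranks in a well-founded family -/

namespace FamilyWF

variable {α : Type u} {μ : Set (Set α)} (hμ : FamilyWF μ)

theorem rank_lt_rank {X Y : μ} (h : (X : Set α) ⊂ Y) : hμ.rank X < hμ.rank Y :=
  Acc.rank_lt_of_rel (hμ.apply Y) h

theorem rank_le_rank {X Y : μ} (h : (X : Set α) ⊆ Y) : hμ.rank X ≤ hμ.rank Y := by
  rcases h.eq_or_ssubset with h | h
  · rw [Subtype.ext h]
  · exact (hμ.rank_lt_rank h).le

theorem lt_rank_iff {o : Ordinal.{u}} {Y : μ} :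
    o < hμ.rank Y ↔ ∃ X : μ, (X : Set α) ⊂ Y ∧ o ≤ hμ.rank X := by
  constructor
  · intro h
    rw [FamilyWF.rank, Acc.rank_eq, Ordinal.lt_iSup_iff] at h
    obtain ⟨X, hX⟩ := h
    exact ⟨X.1, X.2, Order.lt_succ_iff.1 hX⟩
  · rintro ⟨X, hX, h⟩
    exact h.trans_lt (hμ.rank_lt_rank hX)

theorem eq_of_subset_of_rank_eq {X Y : μ} (h : (X : Set α) ⊆ Y) (hr : hμ.rank X = hμ.rank Y) :
    X = Y := by
  rcases h.eq_or_ssubset with h | h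
  · exact Subtype.ext h
  · exact absurd hr (hμ.rank_lt_rank h).ne

end FamilyWF

theorem subset_or_subset_of_familyBelow_eq {α : Type u} {μ : Set (Set α)} {Z X₁ X₂ : μ}
    (h : familyBelow μ Z = familyBelow μ X₁ ∪ familyBelow μ X₂ ∪ {X₁.1, X₂.1}) {W : μ}
    (hW : (W : Set α) ⊂ Z) : (W : Set α) ⊆ X₁ ∨ (W : Set α) ⊆ X₂ := by
  have hW' : (W : Set α) ∈ familyBelow μ Z := ⟨W.2, hW⟩
  rw [h] at hW'
  rcases hW' with (h | h) | h | h
  · exact Or.inl h.2.subset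
  · exact Or.inr h.2.subset
  · exact Or.inl h.le
  · exact Or.inr (show _ = _ from h).le

/-! ### Coherence and interpolation of ranks -/

namespace IsTwoCardinal

variable {κ : Cardinal.{u}} {μ : Set (Set (SuccCard κ))} (hμ : IsTwoCardinal κ μ)

theorem nonempty_orderIso {X Y : μ} (h : hμ.wf.rank X = hμ.wf.rank Y) :
    Nonempty ((X : Set (SuccCard κ)) ≃o (Y : Set (SuccCard κ))) :=
  ⟨(hμ.homogeneous X Y h).choose⟩

theorem familyBelow_eq {X Y : μ} (h : hμ.wf.rank X = hμ.wf.rank Y)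
    (f : (X : Set (SuccCard κ)) ≃o (Y : Set (SuccCard κ))) :
    familyBelow μ Y = {W | ∃ Z ∈ familyBelow μ X, W = isoImage f Z} := by
  obtain ⟨g, hg⟩ := hμ.homogeneous X Y h
  rwa [OrderIso.subsingleton_of_wellFoundedLT.elim f g]

theorem isoImage_mem {X Y : μ} (h : hμ.wf.rank X = hμ.wf.rank Y)
    (f : (X : Set (SuccCard κ)) ≃o (Y : Set (SuccCard κ))) {Z : Set (SuccCard κ)}
    (hZ : Z ∈ familyBelow μ X) : isoImage f Z ∈ familyBelow μ Y := by
  rw [hμ.familyBelow_eq h f]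
  exact ⟨Z, hZ, rfl⟩

/-- By homogeneity `isoImage f` maps the members below `Z` onto those below its image, preserving
inclusion, and rank depends only on these. -/
theorem rank_isoImage {X Y : μ} (h : hμ.wf.rank X = hμ.wf.rank Y)
    (f : (X : Set (SuccCard κ)) ≃o (Y : Set (SuccCard κ))) (Z : μ)
    (hZ : (Z : Set (SuccCard κ)) ⊂ X) :
    hμ.wf.rank ⟨isoImage f Z, (hμ.isoImage_mem h f ⟨Z.2, hZ⟩).1⟩ = hμ.wf.rank Z := by
  induction Z using hμ.wf.induction with
  | _ Z ih =>
    refine eq_of_forall_lt_iff fun o => ?_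
    rw [hμ.wf.lt_rank_iff, hμ.wf.lt_rank_iff]
    constructor
    · rintro ⟨W, hW, ho⟩
      have hWY : (W : Set (SuccCard κ)) ∈ familyBelow μ Y :=
        ⟨W.2, hW.trans (hμ.isoImage_mem h f ⟨Z.2, hZ⟩).2⟩
      rw [hμ.familyBelow_eq h f] at hWY
      obtain ⟨V, hV, hWV⟩ := hWY
      have hVZ : V ⊂ Z := by
        rw [← isoImage_ssubset_isoImage f hV.2.subset hZ.subset, ← hWV]
        exact hW
      refine ⟨⟨V, hV.1⟩, hVZ, ?_⟩
      rw [← ih ⟨V, hV.1⟩ hVZ hV.2]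
      convert ho
      exact hWV.symm
    · rintro ⟨V, hV, ho⟩
      refine ⟨⟨isoImage f V, (hμ.isoImage_mem h f ⟨V.2, hV.trans hZ⟩).1⟩,
        (isoImage_ssubset_isoImage f (hV.trans hZ).subset hZ.subset).2 hV, ?_⟩
      exact ho.trans (ih V hV (hV.trans hZ)).ge

/-- Members of `μ` of equal rank with a common point `a` have the same elements up to `a`. -/
theorem mem_of_le {X Y : μ} (h : hμ.wf.rank X = hμ.wf.rank Y) {a b : SuccCard κ}
    (haX : a ∈ (X : Set (SuccCard κ))) (haY : a ∈ (Y : Set (SuccCard κ))) (hba : b ≤ a)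
    (hb : b ∈ (X : Set (SuccCard κ))) : b ∈ (Y : Set (SuccCard κ)) := by
  -- Induction on a common upper bound `Z`; only the star case with `X` and `Y` in different halves
  -- is not immediate.
  suffices H : ∀ Z X Y : μ, (X : Set (SuccCard κ)) ⊆ Z → (Y : Set (SuccCard κ)) ⊆ Z →
      hμ.wf.rank X = hμ.wf.rank Y → a ∈ (X : Set (SuccCard κ)) → a ∈ (Y : Set (SuccCard κ)) →
      (b ∈ (X : Set (SuccCard κ)) ↔ b ∈ (Y : Set (SuccCard κ))) by
    obtain ⟨Z, hZ, hXZ, hYZ⟩ := hμ.directed X X.2 Y Y.2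
    exact (H ⟨Z, hZ⟩ X Y hXZ hYZ h haX haY).1 hb
  clear! X Y
  intro Z
  induction Z using hμ.wf.induction with
  | _ Z ih =>
    intro X Y hX hY h haX haY
    rcases hX.eq_or_ssubset with hXe | hXs
    · rw [hμ.wf.eq_of_subset_of_rank_eq (hY.trans hXe.ge) h.symm]
    rcases hY.eq_or_ssubset with hYe | hYs
    · rw [hμ.wf.eq_of_subset_of_rank_eq (hX.trans hYe.ge) h]
    rcases hμ.locallyAlmostDirected Z with hd | ⟨X₁, X₂, hr, hs, hfam⟩
    · obtain ⟨W, hW, hXW, hYW⟩ := hd X ⟨X.2, hXs⟩ Y ⟨Y.2, hYs⟩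
      exact ih ⟨W, hW.1⟩ hW.2 X Y hXW hYW h haX haY
    have h₁ : (X₁ : Set (SuccCard κ)) ⊂ Z := by
      have : (X₁ : Set (SuccCard κ)) ∈ familyBelow μ Z := by rw [hfam]; simp
      exact this.2
    have h₂ : (X₂ : Set (SuccCard κ)) ⊂ Z := by
      have : (X₂ : Set (SuccCard κ)) ∈ familyBelow μ Z := by rw [hfam]; simp
      exact this.2
    have hcases := fun W : μ => subset_or_subset_of_familyBelow_eq hfam (W := W)
    have hne : ((X₁ : Set (SuccCard κ)) \ X₂).Nonempty := by
      rw [Set.nonempty_iff_ne_empty]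
      intro he
      rw [Set.sdiff_eq_empty] at he
      have heq := hμ.wf.eq_of_subset_of_rank_eq he hr
      have := hs.2.2.2
      rw [heq, Set.union_self] at this
      exact h₂.ne this.symm
    have mixed : ∀ X Y : μ, (X : Set (SuccCard κ)) ⊆ X₁ → (Y : Set (SuccCard κ)) ⊆ X₂ →
        hμ.wf.rank X = hμ.wf.rank Y → a ∈ (X : Set (SuccCard κ)) →
        a ∈ (Y : Set (SuccCard κ)) →
        (b ∈ (X : Set (SuccCard κ)) ↔ b ∈ (Y : Set (SuccCard κ))) := by
      intro X Y hX hY h haX haY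
      have hag := hs.mem_iff hne (hX haX) (hY haY)
      rcases hX.eq_or_ssubset with hXe | hXs
      · have hY2 : Y = X₂ := hμ.wf.eq_of_subset_of_rank_eq hY (by rw [← h, ← hr, Subtype.ext hXe])
        rw [hY2, hXe]
        exact hag b hba
      -- The isomorphism of the halves fixes everything up to `a`, so `X` can be moved into `X₂`
      -- without changing that part.
      · obtain ⟨f⟩ := hs.1
        have hmem := hμ.isoImage_mem hr f ⟨X.2, hXs⟩
        have hrk := hμ.rank_isoImage hr f X hXs
        have key : ∀ c ≤ a, c ∈ isoImage f (X : Set (SuccCard κ)) ↔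
            c ∈ (X : Set (SuccCard κ)) := by
          intro c hc
          constructor
          · rintro ⟨x, hx, rfl⟩
            have hx1 : (f x : SuccCard κ) ∈ (X₁ : Set (SuccCard κ)) := (hag _ hc).2 (f x).2
            have h3 := orderIso_apply_eq_self f hag _ hx1 hc
            have h4 := f.injective (Subtype.ext h3)
            rw [← h4] at hx
            exact hx
          · intro hcX
            exact ⟨⟨c, hX hcX⟩, hcX, orderIso_apply_eq_self f hag c _ hc⟩
        rw [← key b hba]
        exact ih X₂ h₂ ⟨_, hmem.1⟩ Y hmem.2.subset hY (hrk.trans h) ((key a le_rfl).2 haX) haY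
    rcases hcases X hXs with hX1 | hX2 <;> rcases hcases Y hYs with hY1 | hY2
    · exact ih X₁ h₁ X Y hX1 hY1 h haX haY
    · exact mixed X Y hX1 hY2 h haX haY
    · exact (mixed Y X hY1 hX2 h.symm haY haX).symm
    · exact ih X₂ h₂ X Y hX2 hY2 h haX haY

theorem orderIso_apply_eq {X Y : μ} (h : hμ.wf.rank X = hμ.wf.rank Y)
    (f : (X : Set (SuccCard κ)) ≃o (Y : Set (SuccCard κ))) {a : SuccCard κ}
    (haX : a ∈ (X : Set (SuccCard κ))) (haY : a ∈ (Y : Set (SuccCard κ))) :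
    (f ⟨a, haX⟩ : SuccCard κ) = a :=
  orderIso_apply_eq_self f
    (fun _ hb => ⟨hμ.mem_of_le h haX haY hb, hμ.mem_of_le h.symm haY haX hb⟩) a haX le_rfl

/-- Between two members of `μ` every intermediate rank is realized. -/
theorem exists_rank_eq {X : μ} {δ : Ordinal.{u}} (hX : hμ.wf.rank X ≤ δ) (Z : μ)
    (hXZ : (X : Set (SuccCard κ)) ⊆ Z) (hZ : δ ≤ hμ.wf.rank Z) :
    ∃ Y : μ, (X : Set (SuccCard κ)) ⊆ Y ∧ (Y : Set (SuccCard κ)) ⊆ Z ∧ hμ.wf.rank Y = δ := by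
  induction Z using hμ.wf.induction with
  | _ Z ih =>
    rcases hZ.eq_or_lt with hZ | hZ
    · exact ⟨Z, hXZ, subset_rfl, hZ.symm⟩
    have hXs : (X : Set (SuccCard κ)) ⊂ Z := by
      refine hXZ.ssubset_of_ne fun he => ?_
      rw [Subtype.ext he] at hX
      exact absurd hZ hX.not_gt
    obtain ⟨W, hW, hδW⟩ := hμ.wf.lt_rank_iff.1 hZ
    have step : ∀ V : μ, (V : Set (SuccCard κ)) ⊂ Z → (X : Set (SuccCard κ)) ⊆ V →
        δ ≤ hμ.wf.rank V → ∃ Y : μ, (X : Set (SuccCard κ)) ⊆ Y ∧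
          (Y : Set (SuccCard κ)) ⊆ Z ∧ hμ.wf.rank Y = δ := by
      intro V hV hXV hδ
      obtain ⟨Y, h1, h2, h3⟩ := ih V hV hXV hδ
      exact ⟨Y, h1, h2.trans hV.subset, h3⟩
    -- A proper member above `X` of rank at least `δ` is needed: a common bound of `X` and `W`, or
    -- the half containing `X`, since both halves have equal rank.
    rcases hμ.locallyAlmostDirected Z with hd | ⟨X₁, X₂, hr, hs, hfam⟩
    · obtain ⟨V, hV, hXV, hWV⟩ := hd X ⟨X.2, hXs⟩ W ⟨W.2, hW⟩
      exact step ⟨V, hV.1⟩ hV.2 hXV (hδW.trans (hμ.wf.rank_le_rank hWV))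
    have h₁ : (X₁ : Set (SuccCard κ)) ∈ familyBelow μ Z := by rw [hfam]; simp
    have h₂ : (X₂ : Set (SuccCard κ)) ∈ familyBelow μ Z := by rw [hfam]; simp
    have hcases := fun W : μ => subset_or_subset_of_familyBelow_eq hfam (W := W)
    have hδ₁ : δ ≤ hμ.wf.rank X₁ := by
      rcases hcases W hW with h | h
      · exact hδW.trans (hμ.wf.rank_le_rank h)
      · exact (hδW.trans (hμ.wf.rank_le_rank h)).trans hr.ge
    rcases hcases X hXs with h | h
    · exact step X₁ h₁.2 h hδ₁
    · exact step X₂ h₂.2 h (hδ₁.trans hr.le)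

/-! ### Ultrametric properties of the coloring -/

theorem coloring_le_rank {X : μ} {α β : SuccCard κ} (hα : α ∈ (X : Set (SuccCard κ)))
    (hβ : β ∈ (X : Set (SuccCard κ))) : hμ.coloring α β ≤ hμ.wf.rank X :=
  csInf_le' ⟨X, hα, hβ, rfl⟩

theorem coloring_comm (α β : SuccCard κ) : hμ.coloring α β = hμ.coloring β α := by
  have h : ∀ α β, hμ.coloring α β ≤ hμ.coloring β α := fun α β => by
    obtain ⟨X, hβ, hα, h⟩ := hμ.exists_coloring β α
    exact h ▸ hμ.coloring_le_rank hα hβ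
  exact le_antisymm (h _ _) (h _ _)

/-- Neatness allows a descent to a member of rank zero containing `α`; interpolation then reaches
`δ`. -/
theorem exists_subset_rank_eq {X : μ} {α : SuccCard κ} (hα : α ∈ (X : Set (SuccCard κ)))
    {δ : Ordinal.{u}} (hδ : δ ≤ hμ.wf.rank X) :
    ∃ V : μ, (V : Set (SuccCard κ)) ⊆ X ∧ α ∈ (V : Set (SuccCard κ)) ∧ hμ.wf.rank V = δ := by
  have h0 : ∃ V : μ, (V : Set (SuccCard κ)) ⊆ X ∧ α ∈ (V : Set (SuccCard κ)) ∧
      hμ.wf.rank V = 0 := by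
    clear hδ
    induction X using hμ.wf.induction with
    | _ X ih =>
      by_cases h : hμ.wf.rank X = 0
      · exact ⟨X, subset_rfl, hα, h⟩
      rw [hμ.neat X h] at hα
      obtain ⟨W, hW, hαW⟩ := hα
      obtain ⟨V, h1, h2, h3⟩ := ih ⟨W, hW.1⟩ hW.2 hαW
      exact ⟨V, h1.trans hW.2.subset, h2, h3⟩
  obtain ⟨V, hV, hαV, hr⟩ := h0
  obtain ⟨Y, h1, h2, h3⟩ := hμ.exists_rank_eq (X := V) (hr ▸ zero_le) X hV hδ
  exact ⟨Y, h2, h1 hαV, h3⟩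

/-- Otherwise a point `α` with `κ` predecessors has fewer than `κ` colors below it, and by coherence
each color class lies in one member, of size less than `κ`. -/
theorem exists_le_rank {ρ : Ordinal.{u}} (hρ : ρ < κ.ord) : ∃ Z : μ, ρ ≤ hμ.wf.rank Z := by
  by_contra! hlt
  have hκ : κ.ord < (Order.succ κ).ord := Cardinal.ord_lt_ord.2 (Order.lt_succ κ)
  obtain ⟨α, hα⟩ := Ordinal.typein_surj (α := SuccCard κ) (· < ·)
    (hκ.trans_eq (Ordinal.type_toType _).symm)
  have hcard : #(Set.Iio α) = κ :=
     (congrArg Ordinal.card hα).trans (Cardinal.card_ord κ)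
  have hsub : Set.Iio α ⊆ ⋃ i : ρ.ToType,
      {β | hμ.coloring α β = (Ordinal.ToType.toOrd i : Ordinal.{u}) ∧ β < α} := by
    intro β hβ
    obtain ⟨X, -, -, h⟩ := hμ.exists_coloring α β
    refine Set.mem_iUnion.2 ⟨Ordinal.ToType.mk ⟨hμ.coloring α β, h ▸ hlt X⟩, ?_, hβ⟩
    simp [Ordinal.ToType.toOrd]
  refine absurd (Cardinal.mk_le_mk_of_subset hsub) (not_le.2 ?_)
  rw [hcard, Cardinal.card_iUnion_lt_iff_forall_of_isRegular hμ.regular]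
  · intro i
    rcases Set.eq_empty_or_nonempty
      {β | hμ.coloring α β = (Ordinal.ToType.toOrd i : Ordinal.{u}) ∧ β < α} with he | ⟨β, hβ, -⟩
    · rw [he, Cardinal.mk_eq_zero (∅ : Set (SuccCard κ))]
      exact hμ.regular.pos
    · obtain ⟨X, hα, -, hX⟩ := hμ.exists_coloring α β
      refine (Cardinal.mk_le_mk_of_subset ?_).trans_lt (hμ.card_lt X X.2)
      rintro γ ⟨hγ, hγα⟩
      obtain ⟨Y, hαY, hγY, hY⟩ := hμ.exists_coloring α γ
      exact hμ.mem_of_le (hY.trans (hγ.trans (hβ.symm.trans hX.symm))) hαY hα hγα.le hγY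
  · rw [Cardinal.mk_toType]
    exact Cardinal.lt_ord.1 hρ

theorem exists_superset_rank_eq {X : μ} {δ : Ordinal.{u}} (hX : hμ.wf.rank X ≤ δ)
    (hδ : δ < κ.ord) : ∃ Y : μ, (X : Set (SuccCard κ)) ⊆ Y ∧ hμ.wf.rank Y = δ := by
  obtain ⟨Z, hZ⟩ := hμ.exists_le_rank hδ
  obtain ⟨W, hW, hXW, hZW⟩ := hμ.directed X X.2 Z Z.2
  obtain ⟨Y, h1, -, h3⟩ := hμ.exists_rank_eq hX ⟨W, hW⟩ hXW
    (hZ.trans (hμ.wf.rank_le_rank hZW))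
  exact ⟨Y, h1, h3⟩

theorem exists_mem_rank_eq (α : SuccCard κ) {δ : Ordinal.{u}} (hδ : δ < κ.ord) :
    ∃ X : μ, α ∈ (X : Set (SuccCard κ)) ∧ hμ.wf.rank X = δ := by
  obtain ⟨X, hα, -, -⟩ := hμ.exists_coloring α α
  obtain ⟨V, -, hαV, hV⟩ := hμ.exists_subset_rank_eq hα (δ := 0) zero_le
  obtain ⟨Y, hY, hr⟩ := hμ.exists_superset_rank_eq (X := V) (hV ▸ zero_le) hδ
  exact ⟨Y, hY hαV, hr⟩

/-- A member witnessing the color extends to one of the rank of `X`, which agrees with `X` below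
`α`. -/
theorem coloring_le_iff {X : μ} {α β : SuccCard κ} (hα : α ∈ (X : Set (SuccCard κ)))
    (hβ : β ≤ α) : hμ.coloring α β ≤ hμ.wf.rank X ↔ β ∈ (X : Set (SuccCard κ)) := by
  constructor
  · intro h
    obtain ⟨Y, hαY, hβY, hr⟩ := hμ.exists_coloring α β
    obtain ⟨Z, hYZ, hZ⟩ := hμ.exists_superset_rank_eq (hr.trans_le h) (hμ.rank_lt X)
    exact hμ.mem_of_le hZ (hYZ hαY) hα hβ (hYZ hβY)
  · exact hμ.coloring_le_rank hα

theorem coloring_le_max_of_le_of_le {α β γ : SuccCard κ} (h₁ : α ≤ β) (h₂ : β ≤ γ) :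
    hμ.coloring γ α ≤ max (hμ.coloring β α) (hμ.coloring γ β) := by
  obtain ⟨X, hγ, hX⟩ := hμ.exists_mem_rank_eq γ
    (max_lt (hμ.coloring_lt β α) (hμ.coloring_lt γ β))
  rw [← hX, hμ.coloring_le_iff hγ (h₁.trans h₂)]
  have hβ := (hμ.coloring_le_iff hγ h₂).1 (hX ▸ le_max_right _ _)
  exact (hμ.coloring_le_iff hβ h₁).1 (hX ▸ le_max_left _ _)

theorem coloring_le_max_of_le {α β γ : SuccCard κ} (h₁ : α ≤ β) (h₂ : β ≤ γ) :
    hμ.coloring β α ≤ max (hμ.coloring γ α) (hμ.coloring γ β) := by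
  obtain ⟨X, hγ, hX⟩ := hμ.exists_mem_rank_eq γ
    (max_lt (hμ.coloring_lt γ α) (hμ.coloring_lt γ β))
  rw [← hX]
  exact hμ.coloring_le_rank ((hμ.coloring_le_iff hγ h₂).1 (hX ▸ le_max_right _ _))
    ((hμ.coloring_le_iff hγ (h₁.trans h₂)).1 (hX ▸ le_max_left _ _))

theorem card_coloring_le_lt (α : SuccCard κ) {δ : Ordinal.{u}} (hδ : δ < κ.ord) :
    #{β | β < α ∧ hμ.coloring α β ≤ δ} < κ := by
  obtain ⟨X, hα, hX⟩ := hμ.exists_mem_rank_eq α hδ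
  refine (Cardinal.mk_le_mk_of_subset ?_).trans_lt (hμ.card_lt X X.2)
  rintro β ⟨hβ, h⟩
  exact (hμ.coloring_le_iff hα hβ.le).1 (hX ▸ h)

/-- The order type of the set of predecessors of `α` whose color with `α` is at most `δ`. -/
noncomputable def position (δ : Ordinal.{u}) (α : SuccCard κ) : Ordinal.{u} :=
  typeLT {β | β < α ∧ hμ.coloring α β ≤ δ}

/-- By the ultrametric inequalities, the set measured at `α` is the initial segment, cut at `α`, of
the set measured at `β`. -/
theorem position_lt_position {δ : Ordinal.{u}} {α β : SuccCard κ} (h : α < β)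
    (hm : hμ.coloring β α ≤ δ) : hμ.position δ α < hμ.position δ β := by
  refine PrincipalSeg.ordinal_type_lt
    ⟨⟨⟨fun x => ⟨x.1, x.2.1.trans h, ?_⟩, ?_⟩, ?_⟩, ⟨α, h, hm⟩, ?_⟩
  · exact (hμ.coloring_le_max_of_le_of_le x.2.1.le h.le).trans (max_le x.2.2 hm)
  · intro x y hxy
    exact Subtype.ext (Subtype.mk.inj hxy)
  · rfl
  · rintro ⟨x, hx⟩
    constructor
    · rintro ⟨y, hy⟩
      have : y.1 = x := congrArg Subtype.val hy
      exact this ▸ y.2.1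
    · intro hxα
      have hxα : x < α := hxα
      exact ⟨⟨x, hxα, (hμ.coloring_le_max_of_le hxα.le h.le).trans (max_le hx.2 hm)⟩, rfl⟩

theorem position_injective {δ : Ordinal.{u}} {α α' β : SuccCard κ} (hα : α ≤ β) (hα' : α' ≤ β)
    (hm : hμ.coloring β α ≤ δ) (hm' : hμ.coloring β α' ≤ δ)
    (h : hμ.position δ α = hμ.position δ α') : α = α' := by
  rcases lt_trichotomy α α' with hlt | heq | hgt
  · exact absurd h (hμ.position_lt_position hlt
      ((hμ.coloring_le_max_of_le hlt.le hα').trans (max_le hm hm'))).ne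
  · exact heq
  · exact absurd h (hμ.position_lt_position hgt
      ((hμ.coloring_le_max_of_le hgt.le hα).trans (max_le hm' hm))).ne'

/-- Each measured set lies in a member of rank `δ`, and all of these share one order type. -/
theorem exists_position_le {δ : Ordinal.{u}} (hδ : δ < κ.ord) :
    ∃ B < κ.ord, ∀ α, hμ.position δ α ≤ B := by
  have ⟨α₀⟩ : Nonempty (SuccCard κ) := by
    rw [Ordinal.nonempty_toType_iff]
    exact (Cardinal.ord_pos.2 (Cardinal.succ_pos κ)).ne'
  obtain ⟨X₀, -, hX₀⟩ := hμ.exists_mem_rank_eq α₀ hδ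
  refine ⟨typeLT (X₀ : Set (SuccCard κ)), ?_, fun α => ?_⟩
  · rw [Cardinal.lt_ord, Ordinal.card_type]
    exact hμ.card_lt X₀ X₀.2
  · obtain ⟨X, hα, hX⟩ := hμ.exists_mem_rank_eq α hδ
    obtain ⟨f⟩ := hμ.nonempty_orderIso (hX.trans hX₀.symm)
    rw [← f.ordinalType_congr]
    refine Ordinal.type_mono ?_
    rintro β ⟨hβ, h⟩
    exact (hμ.coloring_le_iff hα hβ.le).1 (hX ▸ h)

/-- At a limit rank `η`, the pair `τ, β` is represented by a pair `τ, γ` of color below `η`. -/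
theorem exists_reflection {η : Ordinal.{u}} (hη : η < κ.ord) (h0 : η ≠ 0)
    (hlim : ∀ δ < η, Order.succ δ < η) (τ β : SuccCard κ) :
    ∃ γ, hμ.coloring τ γ < η ∧ ∀ α, α < τ → α < β → hμ.coloring τ α < η →
      hμ.coloring β α < η → α < γ ∧ hμ.coloring γ α ≤ hμ.coloring β α := by
  obtain ⟨X, hτ, hX⟩ := hμ.exists_mem_rank_eq τ hη
  obtain ⟨Y, hβ, hY⟩ := hμ.exists_mem_rank_eq β hη
  have hYX := hY.trans hX.symm
  obtain ⟨f⟩ := hμ.nonempty_orderIso hYX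
  refine ⟨f ⟨β, hβ⟩, ?_, ?_⟩
  -- A star has successor rank, so `X` is locally directed; by neatness `τ` and `γ` then lie in one
  -- smaller member.
  · have hd : FamilyDirected (familyBelow μ X) := by
      rcases hμ.locallyAlmostDirected X with hd | ⟨X₁, X₂, hr, -, hfam⟩
      · exact hd
      have h₁ : (X₁ : Set (SuccCard κ)) ∈ familyBelow μ X := by rw [hfam]; simp
      have h₂ := hlim _ (hX ▸ hμ.wf.rank_lt_rank h₁.2)
      rw [← hX] at h₂
      obtain ⟨W, hW, hle⟩ := hμ.wf.lt_rank_iff.1 h₂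
      have : hμ.wf.rank W ≤ hμ.wf.rank X₁ := by
        rcases subset_or_subset_of_familyBelow_eq hfam hW with h | h
        · exact hμ.wf.rank_le_rank h
        · exact (hμ.wf.rank_le_rank h).trans hr.ge
      exact absurd (Order.succ_le_iff.1 (hle.trans this)) (lt_irrefl _)
    have hneat := hμ.neat X (hX ▸ h0)
    have hγ := (f ⟨β, hβ⟩).2
    rw [hneat] at hτ
    obtain ⟨V, hV, hτV⟩ := hτ
    obtain ⟨W, hW, hγW⟩ : ∃ W ∈ familyBelow μ X, (f ⟨β, hβ⟩ : SuccCard κ) ∈ W :=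
      hneat.subset hγ
    obtain ⟨U, hU, hVU, hWU⟩ := hd V hV W hW
    exact (hμ.coloring_le_rank (X := ⟨U, hU.1⟩) (hVU hτV) (hWU hγW)).trans_lt
      (hX ▸ hμ.wf.rank_lt_rank hU.2)
  · intro α hατ hαβ hmτ hmβ
    have hαX : α ∈ (X : Set (SuccCard κ)) := (hμ.coloring_le_iff hτ hατ.le).1 (hX ▸ hmτ.le)
    have hαY : α ∈ (Y : Set (SuccCard κ)) := (hμ.coloring_le_iff hβ hαβ.le).1 (hY ▸ hmβ.le)
    have hfα := hμ.orderIso_apply_eq hYX f hαY hαX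
    constructor
    · have : f ⟨α, hαY⟩ < f ⟨β, hβ⟩ := f.lt_iff_lt.2 hαβ
      rw [← hfα]
      exact this
    -- `V` witnesses the color of `β` and `α`; its image contains `γ` and the fixed point `α`, at
    -- the same rank.
    · obtain ⟨V, hVY, hβV, hV⟩ := hμ.exists_subset_rank_eq hβ (hY ▸ hmβ.le)
      have hαV := (hμ.coloring_le_iff hβV hαβ.le).1 hV.ge
      have hVs : (V : Set (SuccCard κ)) ⊂ Y := by
        refine hVY.ssubset_of_ne fun he => ?_
        rw [Subtype.ext he, hY] at hV
        exact hmβ.ne hV.symm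
      rw [← hV, ← hμ.rank_isoImage hYX f V hVs]
      refine hμ.coloring_le_rank ?_ ?_
      · exact (apply_mem_isoImage f _).2 hβV
      · have := (apply_mem_isoImage f (Z := V) ⟨α, hαY⟩).2 hαV
        rwa [hfα] at this

end IsTwoCardinal

/-! ### Closure points and pressing down -/

theorem Cardinal.IsRegular.exists_forall_lt {c : Cardinal.{u}} (hc : c.IsRegular)
    {s : Set c.ord.ToType} (hs : #s < c) : ∃ b, ∀ x ∈ s, x < b := by
  by_contra! h
  refine absurd (Order.cof_le (s := s) fun b => ?_) (not_le.2 ?_)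
  · obtain ⟨x, hx, hbx⟩ := h b
    exact ⟨x, hx, hbx⟩
  · rwa [Ordinal.cof_toType, hc.cof_ord]

theorem Cardinal.IsRegular.mk_Iic_lt {c : Cardinal.{u}} (hc : c.IsRegular) (x : c.ord.ToType) :
    #(Set.Iic x) < c := by
  have := hc.exists_forall_lt (s := {x}) (by simpa using hc.nat_lt 1)
  obtain ⟨b, hb⟩ := this
  refine (Cardinal.mk_le_mk_of_subset fun y hy => ?_).trans_lt
    ((Cardinal.mk_Iio_lt b (by simp)).trans_eq (Cardinal.mk_ord_toType c))
  exact lt_of_le_of_lt hy (hb x rfl)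

/-- The point `η` is closed under the set-valued operation `Cl`, and subsets of size less than
`lam` of its initial segment are bounded below `η`. -/
structure IsClosurePoint (lam : Cardinal.{u}) {K : Type u} [LinearOrder K] (Cl : K → K → Set K)
    (η : K) : Prop where
  bounded : ∀ s ⊆ Set.Iio η, #s < lam → ∃ b < η, ∀ x ∈ s, x < b
  closed : ∀ x < η, ∀ y < η, Cl x y ⊆ Set.Iio η

section ClosurePoint

variable {lam κ : Cardinal.{u}} (hlam : lam.IsRegular) (hκ : κ.IsRegular) (hlt : lam < κ)
  {Cl : κ.ord.ToType → κ.ord.ToType → Set κ.ord.ToType}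
include hlam hκ hlt

/-- The supremum of a `lam`-step closing-off sequence is closed, and regularity of `lam` bounds its
small subsets. -/
theorem exists_isClosurePoint (hCl : ∀ x y, #(Cl x y) < κ) (γ : κ.ord.ToType) :
    ∃ η, γ < η ∧ IsClosurePoint lam Cl η := by
  have hF : ∀ z, ∃ w, z < w ∧ ∀ x ≤ z, ∀ y ≤ z, Cl x y ⊆ Set.Iio w := by
    intro z
    have h1 : #(⋃ x ∈ Set.Iic z, ⋃ y ∈ Set.Iic z, Cl x y : Set κ.ord.ToType) < κ := by
      rw [Cardinal.card_biUnion_lt_iff_forall_of_isRegular hκ (hκ.mk_Iic_lt z)]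
      intro x hx
      rw [Cardinal.card_biUnion_lt_iff_forall_of_isRegular hκ (hκ.mk_Iic_lt z)]
      exact fun y _ => hCl x y
    obtain ⟨b, hb⟩ := hκ.exists_forall_lt h1
    obtain ⟨b', hb'⟩ := hκ.exists_forall_lt (hκ.mk_Iic_lt z)
    refine ⟨max b b', lt_max_of_lt_right (hb' z Set.self_mem_Iic), fun x hx y hy k hk => ?_⟩
    refine lt_max_of_lt_left (hb k ?_)
    simp only [Set.mem_iUnion]
    exact ⟨x, hx, y, hy, hk⟩
  choose F hzF hF using hF
  have hb : ∀ s : Set κ.ord.ToType, ∃ b, #s < κ → ∀ x ∈ s, x < b := by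
    intro s
    by_cases h : #s < κ
    · obtain ⟨b, hb⟩ := hκ.exists_forall_lt h
      exact ⟨b, fun _ => hb⟩
    · exact ⟨γ, fun h' => absurd h' h⟩
  choose bd hbd using hb
  obtain ⟨e, he⟩ : ∃ e : lam.ord.ToType → κ.ord.ToType, ∀ i,
      e i = bd (insert γ (Set.range fun j : Set.Iio i => F (e j))) := by
    let e : lam.ord.ToType → κ.ord.ToType :=
      (wellFounded_lt (α := lam.ord.ToType)).fix
        fun i ih => bd (insert γ (Set.range fun j : Set.Iio i => F (ih j.1 j.2)))
    exact ⟨e, fun i => WellFounded.fix_eq _ _ i⟩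
  have hsmall : ∀ i : lam.ord.ToType,
      #(insert γ (Set.range fun j : Set.Iio i => F (e j)) : Set κ.ord.ToType) < κ := by
    intro i
    refine Cardinal.mk_insert_le.trans_lt (Cardinal.add_lt_of_lt hκ.aleph0_le ?_
      (by simpa using hκ.nat_lt 1))
    exact (Cardinal.mk_range_le.trans_lt (Cardinal.mk_Iio_lt i (by simp))).trans
      (by simpa using hlt)
  have hγe : ∀ i, γ < e i := fun i => by
    rw [he i]
    exact hbd _ (hsmall i) _ (Set.mem_insert _ _)
  have hFe : ∀ i, ∀ j < i, F (e j) < e i := fun i j hj => by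
    rw [he i]
    exact hbd _ (hsmall i) _ (Set.mem_insert_of_mem _ ⟨⟨j, hj⟩, rfl⟩)
  have hnext : ∀ i : lam.ord.ToType, ∃ j, i < j := fun i => by
    obtain ⟨j, hj⟩ := hlam.exists_forall_lt (hlam.mk_Iic_lt i)
    exact ⟨j, hj i Set.self_mem_Iic⟩
  have hmono : StrictMono e := fun i j h => (hzF _).trans (hFe j i h)
  have hub : {b | ∀ i, e i ≤ b}.Nonempty := by
    have h1 : #(Set.range e) < κ := Cardinal.mk_range_le.trans_lt (by simpa using hlt)
    obtain ⟨b, hb⟩ := hκ.exists_forall_lt h1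
    exact ⟨b, fun i => (hb _ ⟨i, rfl⟩).le⟩
  obtain ⟨η, hη, hmin⟩ := (wellFounded_lt (α := κ.ord.ToType)).has_min _ hub
  have hcof : ∀ x < η, ∃ i, x < e i := by
    intro x hx
    by_contra! h
    exact hmin x h hx
  have helt : ∀ i, e i < η := fun i => by
    obtain ⟨j, hj⟩ := hnext i
    exact (hmono hj).trans_le (hη j)
  have ⟨i₀⟩ : Nonempty lam.ord.ToType := by
    rw [Ordinal.nonempty_toType_iff]
    exact hlam.ord_pos.ne'
  refine ⟨η, (hγe i₀).trans (helt i₀), ?_, ?_⟩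
  · intro s hs hslam
    have : Nonempty lam.ord.ToType := ⟨i₀⟩
    choose! i hi using hcof
    obtain ⟨j, hj⟩ := hlam.exists_forall_lt (Cardinal.mk_image_le.trans_lt hslam : #(i '' s) < lam)
    exact ⟨e j, helt j, fun x hx => (hi x (hs hx)).trans (hmono (hj _ ⟨x, hx, rfl⟩))⟩
  · intro x hx y hy k hk
    obtain ⟨i, hi⟩ := hcof x hx
    obtain ⟨i', hi'⟩ := hcof y hy
    obtain ⟨j, hj⟩ := hnext (max i i')
    have h1 : x ≤ e (max i i') := hi.le.trans (hmono.monotone (le_max_left _ _))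
    have h2 : y ≤ e (max i i') := hi'.le.trans (hmono.monotone (le_max_right _ _))
    exact (show k < _ from hF _ x h1 y h2 hk).trans ((hFe j _ hj).trans (helt j))

/-- A regressive function is bounded on an unbounded set of closure points. -/
theorem exists_bounded_of_regressive (hCl : ∀ x y, #(Cl x y) < κ)
    {g : κ.ord.ToType → κ.ord.ToType} (hg : ∀ η, IsClosurePoint lam Cl η → g η < η) :
    ∃ γ, ∀ b, ∃ η, b < η ∧ IsClosurePoint lam Cl η ∧ g η ≤ γ := by
  by_contra! h
  choose h hh using h
  -- Here `h x` is a point beyond which every closure point has `g`-value above `x`. Closing under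
  -- `h` gives `h (g η) < η`, hence `g η < g η`. The starting point is arbitrary.
  obtain ⟨η, -, hη⟩ := exists_isClosurePoint (Cl := fun x y => Cl x y ∪ {h x}) hlam hκ hlt
    (fun x y => (Cardinal.mk_union_le _ _).trans_lt
      (Cardinal.add_lt_of_lt hκ.aleph0_le (hCl x y) (by simpa using hκ.nat_lt 1)))
    (h (hκ.exists_forall_lt (s := ∅) (by simpa using hκ.pos)).choose)
  have hη' : IsClosurePoint lam Cl η :=
    ⟨hη.bounded, fun x hx y hy => Set.subset_union_left.trans (hη.closed x hx y hy)⟩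
  have h1 := hg η hη'
  exact lt_irrefl _ (hh (g η) η (hη.closed _ h1 _ h1 (Or.inr rfl)) hη')

/-- After pressing down, pigeonhole on the codes is applied only to points above the bound `γ`, so
`g ξ ≤ γ < η` holds for all pairs. -/
theorem exists_card_eq_of_regressive (hCl : ∀ x y, #(Cl x y) < κ)
    {g : κ.ord.ToType → κ.ord.ToType} (hg : ∀ η, IsClosurePoint lam Cl η → g η < η)
    {C : Type u} (code : κ.ord.ToType → C)
    (hcode : ∀ γ, #(code '' {η | IsClosurePoint lam Cl η ∧ g η ≤ γ}) < κ) :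
    ∃ A : Set κ.ord.ToType, #A = κ ∧ (∀ η ∈ A, IsClosurePoint lam Cl η) ∧
      (∀ ξ ∈ A, ∀ η ∈ A, code ξ = code η) ∧ ∀ ξ ∈ A, ∀ η ∈ A, g ξ < η := by
  obtain ⟨γ, hγ⟩ := exists_bounded_of_regressive hlam hκ hlt hCl hg
  have hcard : ∀ s : Set κ.ord.ToType, (∀ b, ∃ η, b < η ∧ η ∈ s) → κ ≤ #s := by
    intro s hs
    by_contra! hlt
    obtain ⟨b, hb⟩ := hκ.exists_forall_lt hlt
    obtain ⟨η, hη, hηs⟩ := hs b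
    exact lt_asymm hη (hb η hηs)
  let s : Set κ.ord.ToType := {η | γ < η ∧ IsClosurePoint lam Cl η ∧ g η ≤ γ}
  have hs : κ ≤ #s := by
    refine hcard s fun b => ?_
    obtain ⟨η, h1, h2⟩ := hγ (max b γ)
    exact ⟨η, (le_max_left _ _).trans_lt h1, (le_max_right _ _).trans_lt h1, h2⟩
  let f : s → code '' {η | IsClosurePoint lam Cl η ∧ g η ≤ γ} :=
    fun η => ⟨code η, η, η.2.2, rfl⟩
  obtain ⟨c, t, hts, ht, htc⟩ := Cardinal.infinite_pigeonhole_set f κ hs hκ.aleph0_le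
    (by rw [hκ.cof_ord]; exact hcode γ)
  refine ⟨t, le_antisymm ((Cardinal.mk_set_le t).trans_eq (by simp)) ht,
    fun η hη => (hts hη).2.1, fun ξ hξ η hη => ?_, fun ξ hξ η hη => ?_⟩
  · have h1 := congrArg Subtype.val (htc hξ)
    have h2 := congrArg Subtype.val (htc hη)
    exact h1.trans h2.symm
  · exact (hts hξ).2.2.trans_lt (hts hη).1

end ClosurePoint

/-- The subsets are sorted into `lam` classes by a bound on their size, each class having at most
`lam ^< lam` elements. -/
theorem card_bounded_small_subsets_le {lam : Cardinal.{u}} (hlam : ℵ₀ ≤ lam)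
    (hpow : lam ^< lam = lam) {K : Type u} {s : Set K} (hs : #s ≤ lam) :
    #{t : Set K | t ⊆ s ∧ #t < lam} ≤ lam := by
  have hsub : {t : Set K | t ⊆ s ∧ #t < lam} ⊆
      ⋃ i : lam.ord.ToType, {t : Set K | t ⊆ s ∧ #t ≤ #(Set.Iio i)} := by
    rintro t ⟨hts, ht⟩
    obtain ⟨i, hi⟩ := Ordinal.typein_surj (α := lam.ord.ToType) (· < ·)
      ((Cardinal.ord_lt_ord.2 ht).trans_eq (Ordinal.type_toType _).symm)
    refine Set.mem_iUnion.2 ⟨i, hts, le_of_eq ?_⟩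
    exact ((congrArg Ordinal.card hi).trans (Cardinal.card_ord _)).symm
  refine (Cardinal.mk_le_mk_of_subset hsub).trans ((Cardinal.mk_iUnion_le _).trans ?_)
  rw [Cardinal.mk_ord_toType]
  refine (mul_le_mul_right (ciSup_le' fun i => ?_) _).trans (Cardinal.mul_eq_self hlam).le
  refine (Cardinal.mk_bounded_subset_le s _).trans ?_
  refine (Cardinal.power_le_power_right (max_le hs hlam)).trans ?_
  exact (Cardinal.le_powerlt lam (by simpa using Cardinal.mk_Iio_lt i (by simp))).trans hpow.le

/-! ### Failures below a closed point -/

/-- The properties of the coloring of a `(κ, κ⁺)`-cardinal that the thinning-out argument uses,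
for colors in a well-ordered set `K`. -/
structure IsMorassColoring {P K : Type u} [LinearOrder P] [LinearOrder K] (m : P → P → K)
    (pos : K → P → K) : Prop where
  comm : ∀ α β, m α β = m β α
  trans : ∀ {α β γ}, α ≤ β → β ≤ γ → m γ α ≤ max (m β α) (m γ β)
  coherent : ∀ {α β γ}, α ≤ β → β ≤ γ → m β α ≤ max (m γ α) (m γ β)
  small : ∀ α δ, #{β | β < α ∧ m α β ≤ δ} < #K
  pos_inj : ∀ {δ α α' β}, α ≤ β → α' ≤ β → m β α ≤ δ → m β α' ≤ δ → pos δ α = pos δ α' → α = α'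
  pos_le : ∀ δ, ∃ B, ∀ α, pos δ α ≤ B
  reflection : ∀ η, (∃ δ, δ < η) → (∀ δ < η, ∃ ε < η, δ < ε) → ∀ τ β, ∃ γ, m τ γ < η ∧
    ∀ α, α < τ → α < β → m τ α < η → m β α < η → α < γ ∧ m γ α ≤ m β α

section Closed

variable {P K : Type u} [LinearOrder P] [LinearOrder K]

/-- The point `η` of `K` is closed under the coloring `m`, the positions `pos` and the family
`a`, where the union of `a` is numbered by `idx`. -/
structure IsClosedFor (lam : Cardinal.{u}) (m : P → P → K) (pos : K → P → K) (a : K → Set P)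
    (idx : P → K) (η : K) : Prop where
  bounded : ∀ s ⊆ Set.Iio η, #s < lam → ∃ b < η, ∀ x ∈ s, x < b
  family : ∀ ξ < η, ∀ α ∈ a ξ, idx α < η
  color : ∀ α ∈ ⋃ ξ, a ξ, ∀ β ∈ ⋃ ξ, a ξ, idx α < η → idx β < η → m α β < η
  pred : ∀ α ∈ ⋃ ξ, a ξ, ∀ β, idx α < η → β < α → m α β < η → idx β < η
  position : ∀ δ < η, ∀ α, pos δ α < η

/-- The positions of the points of `s` in the levels determined by the points of `s`. -/
def positionSet (m : P → P → K) (pos : K → P → K) (s : Set P) : Set K :=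
  {k | ∃ τ ∈ s, ∃ α ∈ s, pos (m τ α) α = k}

/-- The part of `a η` and of its positions that lies below `η`. -/
def lowerCode (m : P → P → K) (pos : K → P → K) (a : K → Set P) (idx : P → K) (η : K) :
    Set K × Set K :=
  (idx '' a η ∩ Set.Iio η, positionSet m pos (a η) ∩ Set.Iio η)

omit [LinearOrder P] [LinearOrder K] in
theorem card_positionSet_lt {lam : Cardinal.{u}} (hlam : ℵ₀ ≤ lam) (m : P → P → K)
    (pos : K → P → K) {s : Set P} (hs : #s < lam) : #(positionSet m pos s) < lam := by
  have hsub : positionSet m pos s ⊆ Set.range fun p : s × s => pos (m p.1 p.2) p.2 := by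
    rintro _ ⟨τ, hτ, α, hα, rfl⟩
    exact ⟨(⟨τ, hτ⟩, ⟨α, hα⟩), rfl⟩
  refine ((Cardinal.mk_le_mk_of_subset hsub).trans Cardinal.mk_range_le).trans_lt ?_
  rw [Cardinal.mk_prod, Cardinal.lift_id]
  exact Cardinal.mul_lt_of_lt hlam hs hs

/-- The failure of the conclusion for the pair `ξ, η`, witnessed by `τ` and `β`. -/
def IsBadFor (m : P → P → K) (a : K → Set P) (ξ η : K) (τ β : P) : Prop :=
  τ ∈ a ξ ∩ a η ∧ β ∈ a η \ a ξ ∧ ∃ α ∈ a ξ \ a η,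
    (τ < β ∧ m α β < m α τ) ∨ (τ < α ∧ m α β < m β τ)

variable {lam : Cardinal.{u}} {m : P → P → K} {pos : K → P → K} {a : K → Set P} {idx : P → K}

omit [LinearOrder P] in
-- A number below `ξ` would belong to the common code and, by injectivity, put `α` into `a η`.
theorem le_idx_of_lowerCode_eq (hinj : Set.InjOn idx (⋃ ξ, a ξ)) {ξ η : K}
    (hcode : lowerCode m pos a idx ξ = lowerCode m pos a idx η) {α : P} (hα : α ∈ a ξ \ a η) :
    ξ ≤ idx α := by
  by_contra! h
  have h1 : idx α ∈ (lowerCode m pos a idx ξ).1 := ⟨⟨α, hα.1, rfl⟩, h⟩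
  rw [hcode] at h1
  obtain ⟨⟨α', hα', he⟩, -⟩ := h1
  rw [hinj (Set.mem_iUnion_of_mem _ hα') (Set.mem_iUnion_of_mem _ hα.1) he] at hα'
  exact hα.2 hα'

namespace IsClosedFor

variable {η : K}

theorem exists_gt (h : IsClosedFor lam m pos a idx η) (hlam : ℵ₀ ≤ lam) {x : K} (hx : x < η) :
    ∃ y < η, x < y := by
  obtain ⟨b, hb, hxb⟩ := h.bounded {x} (by simpa using hx)
    (by simpa using Cardinal.one_lt_aleph0.trans_le hlam)
  exact ⟨b, hb, hxb x rfl⟩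

theorem exists_lt (h : IsClosedFor lam m pos a idx η) (hlam : ℵ₀ ≤ lam) : ∃ x, x < η := by
  obtain ⟨b, hb, -⟩ := h.bounded ∅ (by simp)
    (by simpa using Cardinal.aleph0_pos.trans_le hlam)
  exact ⟨b, hb⟩

theorem idx_lt {ξ : K} (hη : IsClosedFor lam m pos a idx η) (hlt : ξ < η)
    (hcode : lowerCode m pos a idx ξ = lowerCode m pos a idx η) {τ : P} (hτ : τ ∈ a ξ ∩ a η) :
    idx τ < ξ := by
  have h1 : idx τ ∈ (lowerCode m pos a idx η).1 :=
    ⟨⟨τ, hτ.2, rfl⟩, hη.family ξ hlt τ hτ.1⟩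
  rw [← hcode] at h1
  exact h1.2

/-- The shape of a failure below a closed point. -/
theorem cases_of_isBadFor {ξ : K} (hη : IsClosedFor lam m pos a idx η)
    (hinj : Set.InjOn idx (⋃ ξ, a ξ)) (hlt : ξ < η)
    (hcode : lowerCode m pos a idx ξ = lowerCode m pos a idx η)
    (hm : IsMorassColoring m pos) {τ β : P} (h : IsBadFor m a ξ η τ β) :
    ∃ α ∈ a ξ \ a η, α < β ∧ m τ α < η ∧
      ((τ < α ∧ m τ α = m β τ ∧ m β α < m β τ) ∨ (α < τ ∧ m β α < m τ α)) := by
  obtain ⟨hτ, hβ, α, hα, h⟩ := h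
  have hαU := Set.mem_iUnion_of_mem _ hα.1
  have hτU := Set.mem_iUnion_of_mem _ hτ.1
  have hβη := le_idx_of_lowerCode_eq hinj hcode.symm hβ
  have hαη := hη.family ξ hlt α hα.1
  have hατ : m α τ < η := hη.color α hαU τ hτU hαη (hη.family ξ hlt τ hτ.1)
  have hne : α ≠ β := fun he => hα.2 (he ▸ hβ.1)
  have hne' : α ≠ τ := fun he => hα.2 (he ▸ hτ.2)
  rcases hne.lt_or_gt with hαβ | hβα
  · refine ⟨α, hα, hαβ, hm.comm α τ ▸ hατ, ?_⟩
    rw [hm.comm α β, hm.comm α τ] at h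
    rcases hne'.lt_or_gt with hlt' | hgt
    · rcases h with h | h
      · exact Or.inr ⟨hlt', h.2⟩
      · exact absurd h.1 hlt'.not_gt
    -- For `τ < α < β`, either failure makes `m β α` the strictly smallest color, so the other two
    -- coincide.
    · have h1 := hm.trans hgt.le hαβ.le
      have h2 := hm.coherent hgt.le hαβ.le
      rw [hm.comm α τ] at h1 h2
      refine Or.inl ⟨hgt, ?_⟩
      rcases h with ⟨-, h⟩ | ⟨-, h⟩
      · have h3 : m β τ ≤ m τ α := by simpa [max_eq_left h.le] using h1
        have h4 : m τ α ≤ m β τ := (le_max_iff.1 h2).resolve_right h.not_ge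
        exact ⟨le_antisymm h4 h3, h.trans_le h4⟩
      · have h3 : m β τ ≤ m τ α := (le_max_iff.1 h1).resolve_right h.not_ge
        have h4 : m τ α ≤ m β τ := by simpa [max_eq_left h.le] using h2
        exact ⟨le_antisymm h4 h3, h⟩
  -- The order `β < α` is impossible: a color below `η` would, by closure, number `β` below `η`.
  · have hge : η ≤ m α β := by
      by_contra! h'
      exact absurd (hη.pred α hαU β hαη hβα h') hβη.not_gt
    exfalso
    rcases h with ⟨-, h⟩ | ⟨hτα, h⟩
    · exact absurd (h.trans hατ) hge.not_gt
    · have hle : m β τ ≤ max (m α β) (m α τ) := by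
        rcases le_total τ β with h' | h'
        · rw [max_comm]
          exact hm.coherent h' hβα.le
        · rw [hm.comm]
          exact hm.coherent h' hτα.le
      rw [max_eq_left (hατ.le.trans hge)] at hle
      exact absurd h hle.not_gt

/-- The bound is the maximum of three: one for the failures counted by positions, the color `m β τ`,
and the reflected color `m τ γ`. -/
theorem exists_bound_of_isBadFor (hlam : ℵ₀ ≤ lam) (hm : IsMorassColoring m pos)
    (hinj : Set.InjOn idx (⋃ ξ, a ξ)) (ha : #(a η) < lam)
    (hη : IsClosedFor lam m pos a idx η) (τ β : P) :
    ∃ b < η, ∀ ξ < η, IsClosedFor lam m pos a idx ξ →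
      lowerCode m pos a idx ξ = lowerCode m pos a idx η → IsBadFor m a ξ η τ β → ξ ≤ b := by
  obtain ⟨γ, hγ, hrefl⟩ := hm.reflection η (hη.exists_lt hlam) (fun _ => hη.exists_gt hlam) τ β
  let s : Set K := {ξ | ξ < η ∧ IsClosedFor lam m pos a idx ξ ∧
    lowerCode m pos a idx ξ = lowerCode m pos a idx η ∧ τ ∈ a ξ ∧ m β τ < ξ ∧
    ∃ α ∈ a ξ \ a η, α < β ∧ m τ α = m β τ ∧ m β α < m β τ}
  have hs : #s < lam := by
    have key : ∀ ξ : s, ∃ α ∈ a ξ \ a η, α < β ∧ m β α < m β τ ∧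
        pos (m β τ) α ∈ positionSet m pos (a η) := by
      rintro ⟨ξ, hξη, hξ, hcode, hτ, hδ, α, hα, hαβ, h1, h2⟩
      refine ⟨α, hα, hαβ, h2, ?_⟩
      have h3 : pos (m β τ) α ∈ (lowerCode m pos a idx ξ).2 :=
        ⟨⟨τ, hτ, α, hα.1, by rw [h1]⟩, hξ.position _ hδ α⟩
      rw [hcode] at h3
      exact h3.1
    choose f hf hfβ hfm hfpos using key
    refine (Cardinal.mk_le_of_injective (f := fun ξ : s =>
      (⟨pos (m β τ) (f ξ), hfpos ξ⟩ : positionSet m pos (a η))) ?_).trans_lt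
      (card_positionSet_lt hlam m pos ha)
    -- Closure of `ξ'` numbers `f ξ` below `ξ'`, whereas `f ξ'` is numbered at or above it.
    have hne : ∀ ξ ξ' : s, ξ < ξ' → f ξ ≠ f ξ' := by
      intro ξ ξ' hlt he
      have h1 := ξ'.2.2.1.family ξ hlt (f ξ) (hf ξ).1
      have h2 := le_idx_of_lowerCode_eq hinj ξ'.2.2.2.1 (hf ξ')
      rw [← he] at h2
      exact absurd h1 h2.not_gt
    intro ξ ξ' h
    have h1 : f ξ = f ξ' := hm.pos_inj (hfβ ξ).le (hfβ ξ').le (hfm ξ).le (hfm ξ').le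
      (congrArg Subtype.val h)
    by_contra hcon
    rcases lt_or_gt_of_ne hcon with h2 | h2
    · exact hne _ _ h2 h1
    · exact hne _ _ h2 h1.symm
  obtain ⟨b, hb, hsb⟩ := hη.bounded s (fun ξ hξ => hξ.1) hs
  -- If `m β τ ≥ η` the first kind of failure cannot occur, so `b` is a dummy value.
  obtain ⟨d, hd, hdδ⟩ : ∃ d < η, m β τ < η → m β τ ≤ d := by
    by_cases h : m β τ < η
    · exact ⟨_, h, fun _ => le_rfl⟩
    · exact ⟨b, hb, fun h' => absurd h' h⟩
  refine ⟨max b (max d (m τ γ)), max_lt hb (max_lt hd hγ), fun ξ hξη hξ hcode hbad => ?_⟩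
  have hτ := hbad.1
  obtain ⟨α, hα, hαβ, hτα, h | h⟩ := hη.cases_of_isBadFor hinj hξη hcode hm hbad
  · obtain ⟨-, h1, h2⟩ := h
    rcases lt_or_ge (m β τ) ξ with h3 | h3
    · exact le_max_of_le_left (hsb ξ ⟨hξη, hξ, hcode, hτ.1, h3, α, hα, hαβ, h1, h2⟩).le
    · exact le_max_of_le_right (le_max_of_le_left (h3.trans (hdδ (h1 ▸ hτα))))
  · obtain ⟨hατ, hlt⟩ := h
    obtain ⟨hαγ, hle⟩ := hrefl α hατ hαβ hτα (hlt.trans hτα)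
    -- A smaller color would let closure of `ξ` at `τ`, numbered below `ξ`, capture `α`.
    have h1 : ξ ≤ m τ α := by
      by_contra! h'
      have h2 := hξ.pred τ (Set.mem_iUnion_of_mem _ hτ.1) α
        (hη.idx_lt hξη hcode hτ) hατ h'
      exact absurd h2 (le_idx_of_lowerCode_eq hinj hcode hα).not_gt
    have h2 : m τ α ≤ max (m γ α) (m τ γ) := by
      rcases le_total γ τ with h' | h'
      · exact hm.trans hαγ.le h'
      · rw [hm.comm τ γ]
        exact hm.coherent hατ.le h'
    have h3 := (le_max_iff.1 h2).resolve_left (hle.trans_lt hlt).not_ge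
    exact le_max_of_le_right (le_max_of_le_right (h1.trans h3))

/-- Fewer than `lam` pairs `τ`, `β` from `a η` matter, so their bounds, and the code itself, are
bounded below `η`. -/
theorem exists_bound (hlam : ℵ₀ ≤ lam) (hm : IsMorassColoring m pos)
    (hinj : Set.InjOn idx (⋃ ξ, a ξ)) (ha : #(a η) < lam)
    (hη : IsClosedFor lam m pos a idx η) :
    ∃ b < η, (∀ ξ < η, IsClosedFor lam m pos a idx ξ →
      lowerCode m pos a idx ξ = lowerCode m pos a idx η → ∀ τ β, IsBadFor m a ξ η τ β → ξ ≤ b) ∧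
      (lowerCode m pos a idx η).1 ⊆ Set.Iic b ∧ (lowerCode m pos a idx η).2 ⊆ Set.Iic b := by
  choose b hb hbad using fun p : a η × a η =>
    hη.exists_bound_of_isBadFor hlam hm hinj ha p.1.1 p.2.1
  obtain ⟨b₀, hb₀, h₀⟩ := hη.bounded (Set.range b) (by rintro _ ⟨p, rfl⟩; exact hb p)
    (Cardinal.mk_range_le.trans_lt (by
      rw [Cardinal.mk_prod, Cardinal.lift_id]
      exact Cardinal.mul_lt_of_lt hlam ha ha))
  obtain ⟨b₁, hb₁, h₁⟩ := hη.bounded (lowerCode m pos a idx η).1 Set.inter_subset_right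
    ((Cardinal.mk_le_mk_of_subset Set.inter_subset_left).trans_lt
      (Cardinal.mk_image_le.trans_lt ha))
  obtain ⟨b₂, hb₂, h₂⟩ := hη.bounded (lowerCode m pos a idx η).2 Set.inter_subset_right
    ((Cardinal.mk_le_mk_of_subset Set.inter_subset_left).trans_lt
      (card_positionSet_lt hlam m pos ha))
  refine ⟨max b₀ (max b₁ b₂), max_lt hb₀ (max_lt hb₁ hb₂), ?_, ?_, ?_⟩
  · intro ξ hlt hξ hcode τ β h
    exact le_max_of_le_left
      ((hbad (⟨τ, h.1.2⟩, ⟨β, h.2.1.1⟩) ξ hlt hξ hcode h).trans (h₀ _ ⟨_, rfl⟩).le)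
  · exact fun x hx => le_max_of_le_right (le_max_of_le_left (h₁ x hx).le)
  · exact fun x hx => le_max_of_le_right (le_max_of_le_right (h₂ x hx).le)

end IsClosedFor

end Closed

/-! ### Assembling the thinning-out argument -/

theorem exists_closure_operation {lam κ : Cardinal.{u}} (hκ : κ.IsRegular) (hlt : lam < κ)
    {P : Type u} [LinearOrder P] {m : P → P → κ.ord.ToType}
    {pos : κ.ord.ToType → P → κ.ord.ToType} (hm : IsMorassColoring m pos)
    {a : κ.ord.ToType → Set P} (ha : ∀ ξ, #(a ξ) < lam) {idx : P → κ.ord.ToType}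
    (hinj : Set.InjOn idx (⋃ ξ, a ξ)) :
    ∃ Cl : κ.ord.ToType → κ.ord.ToType → Set κ.ord.ToType, (∀ x y, #(Cl x y) < κ) ∧
      ∀ η, IsClosurePoint lam Cl η → IsClosedFor lam m pos a idx η := by
  choose B hB using hm.pos_le
  refine ⟨fun x y => ((idx '' a x ∪ {k | ∃ α ∈ ⋃ ξ, a ξ, ∃ β ∈ ⋃ ξ, a ξ,
      idx α = x ∧ idx β = y ∧ m α β = k}) ∪
      {k | ∃ α ∈ ⋃ ξ, a ξ, idx α = x ∧ ∃ β, β < α ∧ m α β ≤ y ∧ idx β = k}) ∪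
      Set.Iic (B x), ?_, ?_⟩
  · intro x y
    have hun : ∀ {s t : Set κ.ord.ToType}, #s < κ → #t < κ → #(s ∪ t : Set _) < κ :=
      fun hs ht => (Cardinal.mk_union_le _ _).trans_lt
        (Cardinal.add_lt_of_lt hκ.aleph0_le hs ht)
    refine hun (hun (hun ?_ ?_) ?_) (hκ.mk_Iic_lt _)
    · exact Cardinal.mk_image_le.trans_lt ((ha x).trans hlt)
    · refine lt_of_le_of_lt ?_ (hκ.nat_lt 1)
      rw [Nat.cast_one, Cardinal.mk_le_one_iff_set_subsingleton]
      rintro _ ⟨α, hα, β, hβ, h1, h2, rfl⟩ _ ⟨α', hα', β', hβ', h1', h2', rfl⟩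
      rw [hinj hα hα' (h1.trans h1'.symm), hinj hβ hβ' (h2.trans h2'.symm)]
    · by_cases h : ∃ α ∈ ⋃ ξ, a ξ, idx α = x
      · obtain ⟨α, hα, hx⟩ := h
        have hsub : {k | ∃ α ∈ ⋃ ξ, a ξ, idx α = x ∧ ∃ β, β < α ∧ m α β ≤ y ∧ idx β = k} ⊆
            idx '' {β | β < α ∧ m α β ≤ y} := by
          rintro _ ⟨α', hα', h1, β, h2, h3, rfl⟩
          rw [hinj hα' hα (h1.trans hx.symm)] at h2 h3
          exact ⟨β, ⟨h2, h3⟩, rfl⟩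
        exact (Cardinal.mk_le_mk_of_subset hsub).trans_lt (Cardinal.mk_image_le.trans_lt
          ((hm.small α y).trans_eq (Cardinal.mk_ord_toType κ)))
      · refine lt_of_le_of_lt ?_ hκ.pos
        rw [nonpos_iff_eq_zero, Cardinal.mk_eq_zero_iff, Set.isEmpty_coe_sort,
          Set.eq_empty_iff_forall_notMem]
        rintro _ ⟨α, hα, hx, -⟩
        exact h ⟨α, hα, hx⟩
  · intro η hη
    refine ⟨hη.bounded, ?_, ?_, ?_, ?_⟩
    · exact fun ξ hξ α hα => hη.closed ξ hξ ξ hξ (Or.inl (Or.inl (Or.inl ⟨α, hα, rfl⟩)))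
    · exact fun α hα β hβ h1 h2 => hη.closed _ h1 _ h2
        (Or.inl (Or.inl (Or.inr ⟨α, hα, β, hβ, rfl, rfl, rfl⟩)))
    · exact fun α hα β h1 h2 h3 => hη.closed _ h1 _ h3
        (Or.inl (Or.inr ⟨α, hα, rfl, β, h2, le_rfl, rfl⟩))
    · exact fun δ hδ α => hη.closed _ hδ _ hδ (Or.inr (hB δ α))

theorem exists_injOn_iUnion {lam κ : Cardinal.{u}} (hκ : κ.IsRegular) (hlt : lam < κ)
    {P : Type u} {a : κ.ord.ToType → Set P} (ha : ∀ ξ, #(a ξ) < lam) :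
    ∃ idx : P → κ.ord.ToType, Set.InjOn idx (⋃ ξ, a ξ) := by
  have h1 : #(⋃ ξ, a ξ) ≤ κ := by
    refine (Cardinal.mk_iUnion_le _).trans ?_
    rw [Cardinal.mk_ord_toType]
    refine (mul_le_mul_right (ciSup_le' fun i => ((ha i).trans hlt).le) _).trans
      (Cardinal.mul_eq_self hκ.aleph0_le).le
  obtain ⟨j⟩ := h1.trans_eq (Cardinal.mk_ord_toType κ).symm
  have ⟨k₀⟩ : Nonempty κ.ord.ToType := by
    rw [Ordinal.nonempty_toType_iff]
    exact hκ.ord_pos.ne'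
  classical
  refine ⟨fun x => if h : x ∈ ⋃ ξ, a ξ then j ⟨x, h⟩ else k₀, fun x hx y hy h => ?_⟩
  simp only [dif_pos hx, dif_pos hy] at h
  exact congrArg Subtype.val (j.injective h)

/-- The thinning-out argument. -/
theorem IsMorassColoring.exists_free_subfamily {lam : Cardinal.{u}} (hlam : lam.IsRegular)
    (hpow : lam ^< lam = lam) {P : Type u} [LinearOrder P]
    {m : P → P → (Order.succ lam).ord.ToType}
    {pos : (Order.succ lam).ord.ToType → P → (Order.succ lam).ord.ToType}
    (hm : IsMorassColoring m pos) {a : (Order.succ lam).ord.ToType → Set P}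
    (ha : ∀ ξ, #(a ξ) < lam) :
    ∃ A : Set (Order.succ lam).ord.ToType, #A = Order.succ lam ∧
      ∀ ξ ∈ A, ∀ η ∈ A, ∀ τ ∈ a ξ ∩ a η, ∀ α ∈ a ξ \ a η, ∀ β ∈ a η \ a ξ,
        (τ < β → m α τ ≤ m α β) ∧ (τ < α → m β τ ≤ m α β) := by
  have hκ := Cardinal.isRegular_succ hlam.aleph0_le
  have hlt := Order.lt_succ lam
  obtain ⟨idx, hinj⟩ := exists_injOn_iUnion hκ hlt ha
  obtain ⟨Cl, hCl, hclosed⟩ := exists_closure_operation hκ hlt hm ha hinj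
  have hg : ∀ η, ∃ b, IsClosurePoint lam Cl η → b < η ∧
      (∀ ξ < η, IsClosedFor lam m pos a idx ξ →
        lowerCode m pos a idx ξ = lowerCode m pos a idx η → ∀ τ β, IsBadFor m a ξ η τ β → ξ ≤ b) ∧
      (lowerCode m pos a idx η).1 ⊆ Set.Iic b ∧ (lowerCode m pos a idx η).2 ⊆ Set.Iic b := by
    intro η
    by_cases h : IsClosurePoint lam Cl η
    · obtain ⟨b, hb⟩ := (hclosed η h).exists_bound hlam.aleph0_le hm hinj (ha η)
      exact ⟨b, fun _ => hb⟩
    · exact ⟨η, fun h' => absurd h' h⟩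
  choose g hg using hg
  obtain ⟨A, hA, hAcl, hAcode, hAg⟩ := exists_card_eq_of_regressive hlam hκ hlt hCl
    (fun η hη => (hg η hη).1) (lowerCode m pos a idx) (by
      -- Both coordinates of a code bounded by `γ` are subsets of `Set.Iic γ` of size less than
      -- `lam`; only here is `hpow` needed.
      intro γ
      have hc := card_bounded_small_subsets_le hlam.aleph0_le hpow
        (Order.lt_succ_iff.1 (hκ.mk_Iic_lt γ))
      refine (Cardinal.mk_le_mk_of_subset (t := {t | t ⊆ Set.Iic γ ∧ #t < lam} ×ˢ
        {t | t ⊆ Set.Iic γ ∧ #t < lam}) ?_).trans_lt ?_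
      · rintro _ ⟨η, ⟨hη, hγ⟩, rfl⟩
        obtain ⟨-, -, h1, h2⟩ := hg η hη
        refine ⟨⟨h1.trans (Set.Iic_subset_Iic.2 hγ), ?_⟩, ⟨h2.trans (Set.Iic_subset_Iic.2 hγ), ?_⟩⟩
        · exact (Cardinal.mk_le_mk_of_subset Set.inter_subset_left).trans_lt
            (Cardinal.mk_image_le.trans_lt (ha η))
        · exact (Cardinal.mk_le_mk_of_subset Set.inter_subset_left).trans_lt
            (card_positionSet_lt hlam.aleph0_le m pos (ha η))
      · rw [Cardinal.mk_setProd, Order.lt_succ_iff]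
        exact (mul_le_mul' hc hc).trans (Cardinal.mul_eq_self hlam.aleph0_le).le)
  have hgood : ∀ ξ ∈ A, ∀ η ∈ A, ξ < η → ∀ τ ∈ a ξ ∩ a η, ∀ α ∈ a ξ \ a η, ∀ β ∈ a η \ a ξ,
      (τ < β → m α τ ≤ m α β) ∧ (τ < α → m β τ ≤ m α β) := by
    intro ξ hξ η hη hlt τ hτ α hα β hβ
    by_contra hcon
    have hbad : IsBadFor m a ξ η τ β := by
      refine ⟨hτ, hβ, α, hα, ?_⟩
      by_contra! h
      exact hcon h
    exact absurd ((hg η (hAcl η hη)).2.1 ξ hlt (hclosed ξ (hAcl ξ hξ)) (hAcode ξ hξ η hη) τ β hbad)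
      (hAg η hη ξ hξ).not_ge
  refine ⟨A, hA, fun ξ hξ η hη τ hτ α hα β hβ => ?_⟩
  rcases lt_trichotomy ξ η with h | h | h
  · exact hgood ξ hξ η hη h τ hτ α hα β hβ
  · exact absurd (h ▸ hα.1) hα.2
  · have := hgood η hη ξ hξ h τ hτ.symm β hβ α hα
    rw [hm.comm β α] at this
    exact this.symm

/-! ### Transfer to the coloring of a two-cardinal -/

/-- The coloring of a `(κ, κ⁺)`-cardinal, with colors in the well-ordered set of size `κ`. -/
theorem IsTwoCardinal.isMorassColoring {κ : Cardinal.{u}} {μ : Set (Set (SuccCard κ))}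
    (hμ : IsTwoCardinal κ μ) :
    ∃ pos, IsMorassColoring
      (fun α β => Ordinal.ToType.mk ⟨hμ.coloring α β, hμ.coloring_lt α β⟩ :
        SuccCard κ → SuccCard κ → κ.ord.ToType) pos := by
  have hlt : ∀ δ : κ.ord.ToType, (Ordinal.ToType.toOrd δ : Ordinal.{u}) < κ.ord :=
    fun δ => (Ordinal.ToType.toOrd δ).2
  have hposlt : ∀ (δ : κ.ord.ToType) α, hμ.position (Ordinal.ToType.toOrd δ) α < κ.ord := by
    intro δ α
    obtain ⟨B, hB, h⟩ := hμ.exists_position_le (hlt δ)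
    exact (h α).trans_lt hB
  have hle : ∀ {o : Ordinal.{u}} (ho : o < κ.ord) (δ : κ.ord.ToType),
      Ordinal.ToType.mk ⟨o, ho⟩ ≤ δ ↔ o ≤ (Ordinal.ToType.toOrd δ : Ordinal.{u}) := by
    intro o ho δ
    rw [← OrderIso.le_symm_apply]
    rfl
  have hltiff : ∀ {o : Ordinal.{u}} (ho : o < κ.ord) (δ : κ.ord.ToType),
      Ordinal.ToType.mk ⟨o, ho⟩ < δ ↔ o < (Ordinal.ToType.toOrd δ : Ordinal.{u}) := by
    intro o ho δ
    rw [← OrderIso.lt_symm_apply]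
    rfl
  have hmk : ∀ {o o' : Ordinal.{u}} (ho : o < κ.ord) (ho' : o' < κ.ord),
      (Ordinal.ToType.mk ⟨o, ho⟩ : κ.ord.ToType) ≤ Ordinal.ToType.mk ⟨o', ho'⟩ ↔ o ≤ o' := by
    intro o o' ho ho'
    rw [OrderIso.le_iff_le]
    rfl
  refine ⟨fun δ α => Ordinal.ToType.mk ⟨hμ.position _ α, hposlt δ α⟩, ?_, ?_, ?_, ?_, ?_, ?_, ?_⟩
  · intro α β
    simp only [hμ.coloring_comm α β]
  · intro α β γ h₁ h₂
    simpa only [le_max_iff, hmk] using hμ.coloring_le_max_of_le_of_le h₁ h₂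
  · intro α β γ h₁ h₂
    simpa only [le_max_iff, hmk] using hμ.coloring_le_max_of_le h₁ h₂
  · intro α δ
    simp only [hle, Cardinal.mk_ord_toType]
    exact hμ.card_coloring_le_lt α (hlt δ)
  · intro δ α α' β h₁ h₂ h₃ h₄ h
    simp only [hle] at h₃ h₄
    have := congrArg Subtype.val (Ordinal.ToType.mk.injective h)
    exact hμ.position_injective h₁ h₂ h₃ h₄ this
  · intro δ
    obtain ⟨B, hB, h⟩ := hμ.exists_position_le (hlt δ)
    exact ⟨Ordinal.ToType.mk ⟨B, hB⟩, fun α => (hmk _ _).2 (h α)⟩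
  · rintro η ⟨δ₀, hδ₀⟩ hlim τ β
    have h0 : (Ordinal.ToType.toOrd η : Ordinal.{u}) ≠ 0 := by
      have : (Ordinal.ToType.toOrd δ₀ : Ordinal.{u}) < Ordinal.ToType.toOrd η :=
        (OrderIso.lt_iff_lt Ordinal.ToType.mk.symm).2 hδ₀
      exact (zero_le.trans_lt this).ne'
    obtain ⟨γ, hγ, h⟩ := hμ.exists_reflection (hlt η) h0 (by
      intro δ hδ
      obtain ⟨ε, hε, hδε⟩ := hlim _ ((hltiff (hδ.trans (hlt η)) η).2 hδ)
      refine (Order.succ_le_of_lt ((hltiff _ ε).1 hδε)).trans_lt ?_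
      exact (OrderIso.lt_iff_lt Ordinal.ToType.mk.symm).2 hε) τ β
    refine ⟨γ, (hltiff _ _).2 hγ, fun α h1 h2 h3 h4 => ?_⟩
    obtain ⟨h5, h6⟩ := h α h1 h2 ((hltiff _ _).1 h3) ((hltiff _ _).1 h4)
    exact ⟨h5, (hmk _ _).2 h6⟩

theorem mainTheorem2 (lam κ : Cardinal.{u}) (hlam : lam.IsRegular) (hpow : lam ^< lam = lam)
    (hκ : κ = Order.succ lam)
    (μ : Set (Set (SuccCard κ))) (hμ : IsTwoCardinal κ μ)
    (a : κ.ord.ToType → Set (SuccCard κ)) (ha : ∀ ξ, #(a ξ) < lam) :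
    ∃ A : Set κ.ord.ToType, #A = κ ∧
      ∀ ξ ∈ A, ∀ η ∈ A, ∀ τ ∈ a ξ ∩ a η, ∀ α ∈ a ξ \ a η, ∀ β ∈ a η \ a ξ,
        (τ < β → hμ.coloring α τ ≤ hμ.coloring α β) ∧
        (τ < α → hμ.coloring β τ ≤ hμ.coloring α β) := by
  subst hκ
  obtain ⟨pos, hm⟩ := hμ.isMorassColoring
  obtain ⟨A, hA, h⟩ := hm.exists_free_subfamily hlam hpow ha
  refine ⟨A, hA, fun ξ hξ η hη τ hτ α hα β hβ => ?_⟩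
  obtain ⟨h₁, h₂⟩ := h ξ hξ η hη τ hτ α hα β hβ
  exact ⟨fun hlt => (OrderIso.le_iff_le Ordinal.ToType.mk).1 (h₁ hlt),
    fun hlt => (OrderIso.le_iff_le Ordinal.ToType.mk).1 (h₂ hlt)⟩
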